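/- **Equational Soundness for unannotated $T^{\mathrm{vec}}$.** Terms $a,b,l$ and types $\phi$ are given, up to renaming of bound variables, by $$a ::= x \mid (a\ a') \mid \lambda x.a \mid 0 \mid (S\ a) \mid (R_{\mathrm{nat}}\ a\ a'\ a'') \mid \mathrm{nil} \mid (\mathrm{cons}\ a\ a') \mid (R_{\mathrm{vec}}\ a\ a'\ a'') \mid \mathrm{join},$$ $$\phi ::= \mathrm{nat} \mid \langle \mathrm{vec}\ \phi\ a\rangle \mid \Pi x{:}\phi.\phi' \mid \forall x{:}\phi.\phi' \mid a = a'.$$ Here $\Pi x{:}\phi.\phi'$ and $\forall x{:}\phi.\phi'$ bind the term variable $x$ in $\phi'$. Reduction $\leadsto$ is the closure under arbitrary contexts of - $(\lambda x.a)\ a' \leadsto [a'/x]a$, - $(R_{\mathrm{nat}}\ a\ a'\ 0) \leadsto a$, and $(R_{\mathrm{nat}}\ a\ a'\ (S\ a'')) \leadsto (a'\ a''\ (R_{\mathrm{nat}}\ a\ a'\ a''))$, - $(R_{\mathrm{vec}}\ a\ a'\ \mathrm{nil}) \leadsto a$, and $(R_{\mathrm{vec}}\ a\ a'\ (\mathrm{cons}\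 a_1\ a'')) \leadsto (a'\ a_1\ a''\ (R_{\mathrm{vec}}\ a\ a'\ a''))$. Terms $a,a'$ are *joinable*, written $a \downarrow a'$, if $a \leadsto^* \hat a$ and $a' \leadsto^* \hat a$ for some $\hat a$, where $\leadsto^*$ is the reflexive-transitive closure of $\leadsto$. A context $\Gamma$ is a finite list of declarations $x:\phi$ of distinct variables. It is $\mathit{Ok}$ if, whenever $\Gamma \equiv \Gamma_1, x:\phi, \Gamma_2$, every free variable of $\phi$ is declared in $\Gamma_1$. Types are not otherwise required to be well formed. The judgment $\Gamma \vdash a : \phi$ is defined inductively by the following rules, in which substitution is capture-avoiding, a newly bound or substituted variable is fresh (in particular not declared in $\Gamma$), and all metavariables range over arbitrary terms and types. - (var) If $\Gamma(x) \equiv \phi$ and $\Gamma\ \mathit{Ok}$, then $\Gamma \vdash x : \phi$. - (join) If $a \downarrow a'$ and $\Gamma\ \mathit{Ok}$, then $\Gamma \vdash \mathrm{join} : a = a'$. - (conv) If $\Gamma \vdash a''' : a' = a''$ and $\Gamma \vdash a : [a'/x]\phi$, then $\Gamma \vdash a : [a''/x]\phi$. - (spec-abs) If $\Gamma, x:\phi'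 \vdash a : \phi$ and $x$ is not free in $a$, then $\Gamma \vdash a : \forall x{:}\phi'.\phi$. - (spec-app) If $\Gamma \vdash a : \forall x{:}\phi'.\phi$ and $\Gamma \vdash a' : \phi'$, then $\Gamma \vdash a : [a'/x]\phi$. - (abs) If $\Gamma, x:\phi' \vdash a : \phi$, then $\Gamma \vdash \lambda x.a : \Pi x{:}\phi'.\phi$. - (app) If $\Gamma \vdash a : \Pi x{:}\phi'.\phi$ and $\Gamma \vdash a' : \phi'$, then $\Gamma \vdash (a\ a') : [a'/x]\phi$. - (zero, nil) If $\Gamma\ \mathit{Ok}$, then $\Gamma \vdash 0 : \mathrm{nat}$ and $\Gamma \vdash \mathrm{nil} : \langle \mathrm{vec}\ \phi\ 0\rangle$. - (succ) If $\Gamma \vdash a : \mathrm{nat}$, then $\Gamma \vdash (S\ a) : \mathrm{nat}$. - (Rnat) If $\Gamma \vdash a'' : \mathrm{nat}$, $\Gamma \vdash a : [0/x]\phi$ and $\Gamma \vdash a' : \Pi y{:}\mathrm{nat}.\,\Pi u{:}[y/x]\phi.\,[(S\ y)/x]\phi$, then $\Gamma \vdash (R_{\mathrm{nat}}\ a\ a'\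 a'') : [a''/x]\phi$. - (cons) If $\Gamma \vdash a : \phi$ and $\Gamma \vdash a' : \langle \mathrm{vec}\ \phi\ l\rangle$, then $\Gamma \vdash (\mathrm{cons}\ a\ a') : \langle \mathrm{vec}\ \phi\ (S\ l)\rangle$. - (Rvec) If $\Gamma \vdash a'' : \langle \mathrm{vec}\ \phi'\ l\rangle$, $\Gamma \vdash a : [0/y, \mathrm{nil}/x]\phi$ and $\Gamma \vdash a' : \Pi z{:}\phi'.\,\forall k{:}\mathrm{nat}.\,\Pi v{:}\langle \mathrm{vec}\ \phi'\ k\rangle.\,\Pi u{:}[k/y, v/x]\phi.\,[(S\ k)/y, (\mathrm{cons}\ z\ v)/x]\phi$, then $\Gamma \vdash (R_{\mathrm{vec}}\ a\ a'\ a'') : [l/y, a''/x]\phi$. **Corollary.** For all terms $a, b_1, b_2$: if $\cdot \vdash a : b_1 = b_2$ is derivable in the empty context, then $b_1 \downarrow b_2$. -/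

import Mathlib

namespace Tvec

/-- Unannotated terms, up to renaming of bound variables (de Bruijn indices):
`lam a` binds the variable `0` of `a`; `var n` under `k` binders with `k ≤ n` is a free variable. -/
inductive Tm : Type
  | var (n : ℕ)
  | app (a b : Tm)
  | lam (a : Tm)
  | zero
  | succ (a : Tm)
  | recNat (a b c : Tm)
  | nil
  | cons (a b : Tm)
  | recVec (a b c : Tm)
  | join

/-- Types: natural numbers, vectors with elements in `φ` and length `l`, dependent products,
intersection types (implicit products), and equations between arbitrary terms.
`pi φ ψ` and `all φ ψ` bind the term variable `0` of `ψ`. -/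
inductive Ty : Type
  | nat
  | vec (φ : Ty) (l : Tm)
  | pi (φ ψ : Ty)
  | all (φ ψ : Ty)
  | eq (a b : Tm)

/-- Extend a map of indices under a binder. -/
def upRen (ξ : ℕ → ℕ) : ℕ → ℕ
  | 0 => 0
  | n + 1 => ξ n + 1

/-- Renaming of the free variables of a term. -/
def Tm.rename : (ℕ → ℕ) → Tm → Tm
  | ξ, .var n => .var (ξ n)
  | ξ, .app a b => .app (a.rename ξ) (b.rename ξ)
  | ξ, .lam a => .lam (a.rename (upRen ξ))
  | _, .zero => .zero
  | ξ, .succ a => .succ (a.rename ξ)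
  | ξ, .recNat a b c => .recNat (a.rename ξ) (b.rename ξ) (c.rename ξ)
  | _, .nil => .nil
  | ξ, .cons a b => .cons (a.rename ξ) (b.rename ξ)
  | ξ, .recVec a b c => .recVec (a.rename ξ) (b.rename ξ) (c.rename ξ)
  | _, .join => .join

/-- `scons a σ` sends `0` to `a` and `n + 1` to `σ n`. -/
def scons (a : Tm) (σ : ℕ → Tm) : ℕ → Tm
  | 0 => a
  | n + 1 => σ n

/-- The substitution that moves the free variables past `k` new ones. -/
def shift (k : ℕ) : ℕ → Tm := fun n => .var (n + k)

/-- Extend a substitution under a binder. -/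
def up (σ : ℕ → Tm) : ℕ → Tm :=
  scons (.var 0) (fun n => (σ n).rename Nat.succ)

/-- Simultaneous capture-avoiding substitution in a term. -/
def Tm.subst : (ℕ → Tm) → Tm → Tm
  | σ, .var n => σ n
  | σ, .app a b => .app (a.subst σ) (b.subst σ)
  | σ, .lam a => .lam (a.subst (up σ))
  | _, .zero => .zero
  | σ, .succ a => .succ (a.subst σ)
  | σ, .recNat a b c => .recNat (a.subst σ) (b.subst σ) (c.subst σ)
  | _, .nil => .nil
  | σ, .cons a b => .cons (a.subst σ) (b.subst σ)
  | σ, .recVec a b c => .recVec (a.subst σ) (b.subst σ) (c.subst σ)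
  | _, .join => .join

/-- Simultaneous capture-avoiding substitution of terms in a type. -/
def Ty.subst : (ℕ → Tm) → Ty → Ty
  | _, .nat => .nat
  | σ, .vec φ l => .vec (φ.subst σ) (l.subst σ)
  | σ, .pi φ ψ => .pi (φ.subst σ) (ψ.subst (up σ))
  | σ, .all φ ψ => .all (φ.subst σ) (ψ.subst (up σ))
  | σ, .eq a b => .eq (a.subst σ) (b.subst σ)

/-- `a.inst b` is `[b/x]a`, where `x` is the variable `0` of `a`. -/
def Tm.inst (a b : Tm) : Tm := a.subst (scons b .var)

/-- `φ.inst b` is `[b/x]φ`, where `x` is the variable `0` of `φ`. -/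
def Ty.inst (φ : Ty) (b : Tm) : Ty := φ.subst (scons b .var)

/-- Free variables of a term. -/
def Tm.FV : Tm → Set ℕ
  | .var n => {n}
  | .app a b => a.FV ∪ b.FV
  | .lam a => {n | n + 1 ∈ a.FV}
  | .zero => ∅
  | .succ a => a.FV
  | .recNat a b c => a.FV ∪ b.FV ∪ c.FV
  | .nil => ∅
  | .cons a b => a.FV ∪ b.FV
  | .recVec a b c => a.FV ∪ b.FV ∪ c.FV
  | .join => ∅

/-- Free (term) variables of a type. -/
def Ty.FV : Ty → Set ℕ
  | .nat => ∅
  | .vec φ l => φ.FV ∪ l.FV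
  | .pi φ ψ => φ.FV ∪ {n | n + 1 ∈ ψ.FV}
  | .all φ ψ => φ.FV ∪ {n | n + 1 ∈ ψ.FV}
  | .eq a b => a.FV ∪ b.FV

/-- One-step reduction: the closure of the five computation rules under arbitrary contexts. -/
inductive Step : Tm → Tm → Prop
  | beta (a b : Tm) : Step (.app (.lam a) b) (a.inst b)
  | recNat_zero (a b : Tm) : Step (.recNat a b .zero) a
  | recNat_succ (a b c : Tm) :
      Step (.recNat a b (.succ c)) (.app (.app b c) (.recNat a b c))
  | recVec_nil (a b : Tm) : Step (.recVec a b .nil) a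
  | recVec_cons (a b c d : Tm) :
      Step (.recVec a b (.cons c d)) (.app (.app (.app b c) d) (.recVec a b d))
  | app_left {a a' : Tm} (b : Tm) : Step a a' → Step (.app a b) (.app a' b)
  | app_right (a : Tm) {b b' : Tm} : Step b b' → Step (.app a b) (.app a b')
  | lam {a a' : Tm} : Step a a' → Step (.lam a) (.lam a')
  | succ {a a' : Tm} : Step a a' → Step (.succ a) (.succ a')
  | recNat_fst {a a' : Tm} (b c : Tm) : Step a a' → Step (.recNat a b c) (.recNat a' b c)
  | recNat_snd (a : Tm) {b b' : Tm} (c : Tm) :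
      Step b b' → Step (.recNat a b c) (.recNat a b' c)
  | recNat_trd (a b : Tm) {c c' : Tm} : Step c c' → Step (.recNat a b c) (.recNat a b c')
  | cons_left {a a' : Tm} (b : Tm) : Step a a' → Step (.cons a b) (.cons a' b)
  | cons_right (a : Tm) {b b' : Tm} : Step b b' → Step (.cons a b) (.cons a b')
  | recVec_fst {a a' : Tm} (b c : Tm) : Step a a' → Step (.recVec a b c) (.recVec a' b c)
  | recVec_snd (a : Tm) {b b' : Tm} (c : Tm) :
      Step b b' → Step (.recVec a b c) (.recVec a b' c)
  | recVec_trd (a b : Tm) {c c' : Tm} : Step c c' → Step (.recVec a b c) (.recVec a b c')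

/-- Joinability: two terms reduce, in finitely many (possibly zero) steps, to a common term. -/
def Joinable (a b : Tm) : Prop := Relation.Join (Relation.ReflTransGen Step) a b

/-- Typing contexts, the most recent declaration first. The variable `i` is declared by the
entry at position `i`, whose type is expressed in the variables declared before it. -/
abbrev Ctx : Type := List Ty

/-- Whenever `Γ` is `Γ₁, x : φ, Γ₂`, the free variables of `φ` are declared in `Γ₁`. -/
def Ctx.Ok (Γ : Ctx) : Prop :=
  ∀ (Γ₂ : Ctx) (φ : Ty) (Γ₁ : Ctx), Γ = Γ₂ ++ φ :: Γ₁ → φ.FV ⊆ {n | n < Γ₁.length}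

/-- Type assignment `Γ ⊢ a : φ`. The types occurring in a judgement are arbitrary: they need not be
well-formed, and may have free variables that `Γ` does not declare.
In `conv`, `spec_abs`, `spec_app`, `abs`, `app` and `recNat` the variable `x` is the
variable `0` of `φ`; in `recVec`, `x` is the variable `0` and `y` the variable `1` of `φ`. -/
inductive HasType : Ctx → Tm → Ty → Prop
  | var {Γ : Ctx} {i : ℕ} {φ : Ty} :
      Γ[i]? = some φ → Γ.Ok → HasType Γ (.var i) (φ.subst (shift (i + 1)))
  | join {Γ : Ctx} {a a' : Tm} : Joinable a a' → Γ.Ok → HasType Γ .join (.eq a a')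
  | conv {Γ : Ctx} {a a' a'' a''' : Tm} {φ : Ty} :
      HasType Γ a''' (.eq a' a'') → HasType Γ a (φ.inst a') → HasType Γ a (φ.inst a'')
  /-- The term `a`, moved past the new variable `x`, is the general form of a term over
  `Γ, x : φ'` in which `x` does not occur free. -/
  | spec_abs {Γ : Ctx} {a : Tm} {φ' φ : Ty} :
      HasType (φ' :: Γ) (a.subst (shift 1)) φ → HasType Γ a (.all φ' φ)
  | spec_app {Γ : Ctx} {a a' : Tm} {φ' φ : Ty} :
      HasType Γ a (.all φ' φ) → HasType Γ a' φ' → HasType Γ a (φ.inst a')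
  | abs {Γ : Ctx} {a : Tm} {φ' φ : Ty} :
      HasType (φ' :: Γ) a φ → HasType Γ (.lam a) (.pi φ' φ)
  | app {Γ : Ctx} {a a' : Tm} {φ' φ : Ty} :
      HasType Γ a (.pi φ' φ) → HasType Γ a' φ' → HasType Γ (.app a a') (φ.inst a')
  | zero {Γ : Ctx} : Γ.Ok → HasType Γ .zero .nat
  | nil {Γ : Ctx} {φ : Ty} : Γ.Ok → HasType Γ .nil (.vec φ .zero)
  | succ {Γ : Ctx} {a : Tm} : HasType Γ a .nat → HasType Γ (.succ a) .nat
  /-- The third premise is `Γ ⊢ a' : Π y : nat. Π u : [y/x]φ. [(S y)/x]φ`. -/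
  | recNat {Γ : Ctx} {a a' a'' : Tm} {φ : Ty} :
      HasType Γ a'' .nat →
      HasType Γ a (φ.inst .zero) →
      HasType Γ a'
        (.pi .nat
          (.pi (φ.subst (scons (.var 0) (shift 1)))
            (φ.subst (scons (.succ (.var 1)) (shift 2))))) →
      HasType Γ (.recNat a a' a'') (φ.inst a'')
  | cons {Γ : Ctx} {a a' l : Tm} {φ : Ty} :
      HasType Γ a φ → HasType Γ a' (.vec φ l) → HasType Γ (.cons a a') (.vec φ (.succ l))
  /-- The third premise is
  `Γ ⊢ a' : Π z : φ'. ∀ k : nat. Π v : ⟨vec φ' k⟩. Π u : [k/y, v/x]φ. [(S k)/y, (cons z v)/x]φ`. -/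
  | recVec {Γ : Ctx} {a a' a'' l : Tm} {φ' φ : Ty} :
      HasType Γ a'' (.vec φ' l) →
      HasType Γ a (φ.subst (scons .nil (scons .zero .var))) →
      HasType Γ a'
        (.pi φ'
          (.all .nat
            (.pi (.vec (φ'.subst (shift 2)) (.var 0))
              (.pi (φ.subst (scons (.var 0) (scons (.var 1) (shift 3))))
                (φ.subst
                  (scons (.cons (.var 3) (.var 1)) (scons (.succ (.var 2)) (shift 4)))))))) →
      HasType Γ (.recVec a a' a'') (φ.subst (scons a'' (scons l .var)))

end Tvec

namespace Tvec

open Relation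

/-! ### Substitution calculus -/

/-! The proof is a realizability argument. Under a valuation of its variables by arbitrary, possibly
open, terms, each type denotes a set of terms closed under joinability: `nat` and vectors by
convertibility to canonical forms, Π by application, ∀ by intersection. An equation denotes every
term when its two instances are joinable, and nothing otherwise. Soundness (`HasType.sem`) is an
induction on derivations; the identity valuation trivially realizes the empty context and returns
the two sides of the equation themselves.

No normalization is needed, and ill-formed types cause no trouble, because every type has a
denotation. Two facts carry the argument: joinability is a congruent equivalence, whose transitivity
is confluence (`Par.develop`), and denotations are invariant under joinable changes of both realizer
and valuation (`Ty.sem_congr`), which validates conv. -/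

theorem up_var_comp (ξ : ℕ → ℕ) : up (fun n => .var (ξ n)) = fun n => .var (upRen ξ n) := by
  funext n; cases n <;> rfl

theorem Tm.rename_eq_subst (a : Tm) : ∀ ξ : ℕ → ℕ, a.rename ξ = a.subst (fun n => .var (ξ n)) := by
  induction a <;> intro ξ <;> simp_all [Tm.rename, Tm.subst, up_var_comp]

theorem up_comp_upRen (σ : ℕ → Tm) (ξ : ℕ → ℕ) :
    (fun n => up σ (upRen ξ n)) = up (fun n => σ (ξ n)) := by
  funext n; cases n <;> rfl

theorem Tm.subst_rename (a : Tm) :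
    ∀ (ξ : ℕ → ℕ) (σ : ℕ → Tm), (a.rename ξ).subst σ = a.subst (fun n => σ (ξ n)) := by
  induction a <;> intro ξ σ <;> simp_all [Tm.rename, Tm.subst, up_comp_upRen]

theorem Tm.rename_rename (a : Tm) (ξ ζ : ℕ → ℕ) :
    (a.rename ξ).rename ζ = a.rename (fun n => ζ (ξ n)) := by
  rw [Tm.rename_eq_subst _ ζ, Tm.subst_rename, Tm.rename_eq_subst]

theorem rename_up (σ : ℕ → Tm) (ξ : ℕ → ℕ) :
    (fun n => (up σ n).rename (upRen ξ)) = up (fun n => (σ n).rename ξ) := by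
  funext n
  cases n with
  | zero => rfl
  | succ n => simp only [up, scons, Tm.rename_rename, upRen]

theorem Tm.rename_subst (a : Tm) :
    ∀ (σ : ℕ → Tm) (ξ : ℕ → ℕ), (a.subst σ).rename ξ = a.subst (fun n => (σ n).rename ξ) := by
  induction a <;> intro σ ξ <;> simp_all [Tm.rename, Tm.subst, rename_up]

theorem subst_up (σ τ : ℕ → Tm) :
    (fun n => (up σ n).subst (up τ)) = up (fun n => (σ n).subst τ) := by
  funext n
  cases n with
  | zero => rfl
  | succ n => simp only [up, scons, Tm.subst_rename, Tm.rename_subst]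

/-- The lambda case needs `subst_up`; since `up` is defined by renaming, that rests on both mixed
laws for renaming and substitution. -/
theorem Tm.subst_subst (a : Tm) :
    ∀ σ τ : ℕ → Tm, (a.subst σ).subst τ = a.subst (fun n => (σ n).subst τ) := by
  induction a <;> intro σ τ <;> simp_all [Tm.subst, subst_up]

theorem up_var : up .var = .var := by
  funext n; cases n <;> rfl

theorem Tm.subst_var (a : Tm) : a.subst .var = a := by
  induction a <;> simp_all [Tm.subst, up_var]

theorem subst_up_scons (σ τ : ℕ → Tm) (b : Tm) :
    (fun n => (up σ n).subst (scons b τ)) = scons b (fun n => (σ n).subst τ) := by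
  funext n
  cases n with
  | zero => rfl
  | succ n => simp only [up, scons, Tm.subst_rename]

theorem subst_scons (σ τ : ℕ → Tm) (b : Tm) :
    (fun n => (scons b σ n).subst τ) = scons (b.subst τ) (fun n => (σ n).subst τ) := by
  funext n; cases n <;> rfl

theorem Tm.inst_subst (a b : Tm) (σ : ℕ → Tm) :
    (a.inst b).subst σ = a.subst (scons (b.subst σ) σ) := by
  simp only [Tm.inst, Tm.subst_subst, subst_scons, Tm.subst]

theorem Tm.subst_up_inst (a b : Tm) (σ : ℕ → Tm) :
    (a.subst (up σ)).inst b = a.subst (scons b σ) := by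
  simp only [Tm.inst, Tm.subst_subst, subst_up_scons, Tm.subst_var]

/-! ### Parallel reduction -/

/-- Parallel reduction: contraction of any set of redexes of a term. -/
inductive Par : Tm → Tm → Prop
  | var (n : ℕ) : Par (.var n) (.var n)
  | app {a a' b b' : Tm} : Par a a' → Par b b' → Par (.app a b) (.app a' b')
  | lam {a a' : Tm} : Par a a' → Par (.lam a) (.lam a')
  | zero : Par .zero .zero
  | succ {a a' : Tm} : Par a a' → Par (.succ a) (.succ a')
  | recNat {a a' b b' c c' : Tm} :
      Par a a' → Par b b' → Par c c' → Par (.recNat a b c) (.recNat a' b' c')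
  | nil : Par .nil .nil
  | cons {a a' b b' : Tm} : Par a a' → Par b b' → Par (.cons a b) (.cons a' b')
  | recVec {a a' b b' c c' : Tm} :
      Par a a' → Par b b' → Par c c' → Par (.recVec a b c) (.recVec a' b' c')
  | join : Par .join .join
  | beta {a a' b b' : Tm} : Par a a' → Par b b' → Par (.app (.lam a) b) (a'.inst b')
  | recNat_zero {a a' : Tm} (b : Tm) : Par a a' → Par (.recNat a b .zero) a'
  | recNat_succ {a a' b b' c c' : Tm} : Par a a' → Par b b' → Par c c' →
      Par (.recNat a b (.succ c)) (.app (.app b' c') (.recNat a' b' c'))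
  | recVec_nil {a a' : Tm} (b : Tm) : Par a a' → Par (.recVec a b .nil) a'
  | recVec_cons {a a' b b' c c' d d' : Tm} : Par a a' → Par b b' → Par c c' → Par d d' →
      Par (.recVec a b (.cons c d)) (.app (.app (.app b' c') d') (.recVec a' b' d'))

theorem Par.refl (a : Tm) : Par a a := by
  induction a <;> constructor <;> assumption

theorem Step.par {a b : Tm} (h : Step a b) : Par a b := by
  induction h <;> constructor <;> first | assumption | exact Par.refl _

theorem Tm.inst_rename (a b : Tm) (ξ : ℕ → ℕ) :
    (a.inst b).rename ξ = (a.rename (upRen ξ)).inst (b.rename ξ) := by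
  simp only [Tm.inst, Tm.rename_subst, Tm.subst_rename]
  congr 1
  funext n; cases n <;> rfl

theorem Par.rename {a a' : Tm} (h : Par a a') : ∀ ξ : ℕ → ℕ, Par (a.rename ξ) (a'.rename ξ) := by
  induction h with
  | beta _ _ iha ihb =>
    intro ξ
    rw [Tm.inst_rename]
    exact .beta (iha _) (ihb _)
  | var n => exact fun ξ => .var _
  | _ => intro ξ; constructor <;> apply_assumption

theorem Par.up {σ τ : ℕ → Tm} (h : ∀ n, Par (σ n) (τ n)) : ∀ n, Par (up σ n) (up τ n)
  | 0 => .var 0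
  | n + 1 => (h n).rename _

/-- The valuations may reduce too, as is needed when a contracted β-redex has both its body and its
argument reduced. -/
theorem Par.subst {a a' : Tm} (h : Par a a') :
    ∀ {σ τ : ℕ → Tm}, (∀ n, Par (σ n) (τ n)) → Par (a.subst σ) (a'.subst τ) := by
  induction h with
  | beta _ _ iha ihb =>
    intro σ τ hst
    rw [Tm.inst_subst, ← Tm.subst_up_inst]
    exact .beta (iha (Par.up hst)) (ihb hst)
  | var n => exact fun hst => hst n
  | lam _ ih => exact fun hst => .lam (ih (Par.up hst))
  | _ => intro σ τ hst; constructor <;> apply_assumption <;> exact hst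

theorem Par.inst {a a' b b' : Tm} (ha : Par a a') (hb : Par b b') :
    Par (a.inst b) (a'.inst b') :=
  ha.subst fun n => by
    cases n with
    | zero => exact hb
    | succ n => exact .var n

/-- Complete development: contraction of all redexes of a term. -/
def Tm.develop : Tm → Tm
  | .var n => .var n
  | .app (.lam a) b => a.develop.inst b.develop
  | .app a b => .app a.develop b.develop
  | .lam a => .lam a.develop
  | .zero => .zero
  | .succ a => .succ a.develop
  | .recNat a _ .zero => a.develop
  | .recNat a b (.succ c) =>
      .app (.app b.develop c.develop) (.recNat a.develop b.develop c.develop)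
  | .recNat a b c => .recNat a.develop b.develop c.develop
  | .nil => .nil
  | .cons a b => .cons a.develop b.develop
  | .recVec a _ .nil => a.develop
  | .recVec a b (.cons c d) =>
      .app (.app (.app b.develop c.develop) d.develop) (.recVec a.develop b.develop d.develop)
  | .recVec a b c => .recVec a.develop b.develop c.develop
  | .join => .join

/-- Takahashi's triangle property: the target depends on `a` alone, so any two parallel reducts of
`a` meet there in one step. -/
theorem Par.develop {a b : Tm} (h : Par a b) : Par b a.develop := by
  induction h with
  | @app a a' b b' ha hb iha ihb =>
    -- Whether `develop` contracts here depends on the shape of the head; for an abstraction,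
    -- inverting both reductions exposes the body.
    cases a with
    | lam a =>
      cases ha with
      | lam ha =>
        cases iha with
        | lam iha => exact .beta iha ihb
    | _ => exact .app iha ihb
  | @recNat a a' b b' c c' ha hb hc iha ihb ihc =>
    cases c with
    | zero => cases hc; exact .recNat_zero _ iha
    | succ c =>
      cases hc with
      | succ hc =>
        cases ihc with
        | succ ihc => exact .recNat_succ iha ihb ihc
    | _ => exact .recNat iha ihb ihc
  | @recVec a a' b b' c c' ha hb hc iha ihb ihc =>
    cases c with
    | nil => cases hc; exact .recVec_nil _ iha
    | cons c d =>
      cases hc with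
      | cons hc hd =>
        cases ihc with
        | cons ihc ihd => exact .recVec_cons iha ihb ihc ihd
    | _ => exact .recVec iha ihb ihc
  | beta _ _ iha ihb => exact iha.inst ihb
  | recNat_zero b _ ih => exact ih
  | recVec_nil b _ ih => exact ih
  | recNat_succ _ _ _ iha ihb ihc => exact .app (.app ihb ihc) (.recNat iha ihb ihc)
  | recVec_cons _ _ _ _ iha ihb ihc ihd =>
    exact .app (.app (.app ihb ihc) ihd) (.recVec iha ihb ihd)
  | _ => constructor <;> assumption

/-! ### Joinability is a congruence -/

/-- Many-step reduction. -/
abbrev Steps : Tm → Tm → Prop := ReflTransGen Step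

theorem Steps.map {f : Tm → Tm} (hf : ∀ {a b}, Step a b → Step (f a) (f b)) {a b : Tm}
    (h : Steps a b) : Steps (f a) (f b) :=
  ReflTransGen.lift f (fun _ _ => hf) _ _ h

theorem Steps.app {a a' b b' : Tm} (ha : Steps a a') (hb : Steps b b') :
    Steps (.app a b) (.app a' b') :=
  (ha.map (f := fun a => .app a b) (.app_left b)).trans (hb.map (.app_right a'))

theorem Steps.cons {a a' b b' : Tm} (ha : Steps a a') (hb : Steps b b') :
    Steps (.cons a b) (.cons a' b') :=
  (ha.map (f := fun a => .cons a b) (.cons_left b)).trans (hb.map (.cons_right a'))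

theorem Steps.recNat {a a' b b' c c' : Tm} (ha : Steps a a') (hb : Steps b b')
    (hc : Steps c c') : Steps (.recNat a b c) (.recNat a' b' c') :=
  ((ha.map (f := fun a => .recNat a b c) (.recNat_fst b c)).trans
    (hb.map (f := fun b => .recNat a' b c) (.recNat_snd a' c))).trans (hc.map (.recNat_trd a' b'))

theorem Steps.recVec {a a' b b' c c' : Tm} (ha : Steps a a') (hb : Steps b b')
    (hc : Steps c c') : Steps (.recVec a b c) (.recVec a' b' c') :=
  ((ha.map (f := fun a => .recVec a b c) (.recVec_fst b c)).trans
    (hb.map (f := fun b => .recVec a' b c) (.recVec_snd a' c))).trans (hc.map (.recVec_trd a' b'))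

theorem Par.steps {a b : Tm} (h : Par a b) : Steps a b := by
  induction h with
  | var | zero | nil | join => exact .refl
  | app _ _ iha ihb => exact iha.app ihb
  | lam _ ih => exact ih.map .lam
  | succ _ ih => exact ih.map .succ
  | cons _ _ iha ihb => exact iha.cons ihb
  | recNat _ _ _ iha ihb ihc => exact iha.recNat ihb ihc
  | recVec _ _ _ iha ihb ihc => exact iha.recVec ihb ihc
  | beta _ _ iha ihb => exact ((iha.map .lam).app ihb).tail (.beta _ _)
  | recNat_zero b _ ih => exact .head (.recNat_zero _ b) ih
  | recVec_nil b _ ih => exact .head (.recVec_nil _ b) ih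
  | recNat_succ _ _ _ iha ihb ihc =>
    exact .head (.recNat_succ _ _ _) ((ihb.app ihc).app (iha.recNat ihb ihc))
  | recVec_cons _ _ _ _ iha ihb ihc ihd =>
    exact .head (.recVec_cons _ _ _ _) (((ihb.app ihc).app ihd).app (iha.recVec ihb ihd))

theorem reflTransGen_par : ReflTransGen Par = Steps := by
  funext a b
  exact propext ⟨fun h => reflTransGen_closed (fun _ _ => Par.steps) _ _ h,
    fun h => ReflTransGen.mono (fun _ _ => Step.par) _ _ h⟩

/-- Transitivity is the Church–Rosser property, obtained from the diamond for `Par`, which has the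
same reflexive-transitive closure as `Step`. -/
theorem joinable_equivalence : Equivalence Joinable := by
  have h : Equivalence (Join (ReflTransGen Par)) :=
    equivalence_join_reflTransGen fun a b c hb hc =>
      ⟨a.develop, .single hb.develop, .single hc.develop⟩
  rw [reflTransGen_par] at h
  exact h

theorem Joinable.refl (a : Tm) : Joinable a a := joinable_equivalence.refl a

theorem Joinable.symm {a b : Tm} (h : Joinable a b) : Joinable b a := joinable_equivalence.symm h

theorem Joinable.trans {a b c : Tm} (h : Joinable a b) (h' : Joinable b c) : Joinable a c :=
  joinable_equivalence.trans h h'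

theorem Steps.joinable {a b : Tm} (h : Steps a b) : Joinable a b := ⟨b, h, .refl⟩

theorem Step.joinable {a b : Tm} (h : Step a b) : Joinable a b := Steps.joinable (.single h)

theorem Joinable.app {a a' b b' : Tm} : Joinable a a' → Joinable b b' →
    Joinable (.app a b) (.app a' b')
  | ⟨_, h₁, h₁'⟩, ⟨_, h₂, h₂'⟩ => ⟨_, Steps.app h₁ h₂, Steps.app h₁' h₂'⟩

theorem Joinable.cons {a a' b b' : Tm} : Joinable a a' → Joinable b b' →
    Joinable (.cons a b) (.cons a' b')
  | ⟨_, h₁, h₁'⟩, ⟨_, h₂, h₂'⟩ => ⟨_, Steps.cons h₁ h₂, Steps.cons h₁' h₂'⟩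

theorem Joinable.lam {a a' : Tm} : Joinable a a' → Joinable (.lam a) (.lam a')
  | ⟨_, h, h'⟩ => ⟨_, Steps.map .lam h, Steps.map .lam h'⟩

theorem Joinable.succ {a a' : Tm} : Joinable a a' → Joinable (.succ a) (.succ a')
  | ⟨_, h, h'⟩ => ⟨_, Steps.map .succ h, Steps.map .succ h'⟩

theorem Joinable.recNat {a a' b b' c c' : Tm} : Joinable a a' → Joinable b b' → Joinable c c' →
    Joinable (.recNat a b c) (.recNat a' b' c')
  | ⟨_, h₁, h₁'⟩, ⟨_, h₂, h₂'⟩, ⟨_, h₃, h₃'⟩ =>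
    ⟨_, Steps.recNat h₁ h₂ h₃, Steps.recNat h₁' h₂' h₃'⟩

theorem Joinable.recVec {a a' b b' c c' : Tm} : Joinable a a' → Joinable b b' → Joinable c c' →
    Joinable (.recVec a b c) (.recVec a' b' c')
  | ⟨_, h₁, h₁'⟩, ⟨_, h₂, h₂'⟩, ⟨_, h₃, h₃'⟩ =>
    ⟨_, Steps.recVec h₁ h₂ h₃, Steps.recVec h₁' h₂' h₃'⟩

theorem Joinable.subst {a b : Tm} (h : Joinable a b) (σ : ℕ → Tm) :
    Joinable (a.subst σ) (b.subst σ) := by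
  have key {a b : Tm} (h : Steps a b) : Steps (a.subst σ) (b.subst σ) := by
    rw [← reflTransGen_par] at h ⊢
    exact ReflTransGen.lift (fun a => a.subst σ) (fun _ _ h => h.subst fun n => .refl _) _ _ h
  obtain ⟨c, ha, hb⟩ := h
  exact ⟨_, key ha, key hb⟩

theorem Joinable.up {σ τ : ℕ → Tm} (h : ∀ n, Joinable (σ n) (τ n)) :
    ∀ n, Joinable (up σ n) (up τ n)
  | 0 => .refl _
  | n + 1 => by
    simp only [Tvec.up, scons, Tm.rename_eq_subst]
    exact (h n).subst _

theorem Joinable.subst_congr (a : Tm) : ∀ {σ τ : ℕ → Tm}, (∀ n, Joinable (σ n) (τ n)) →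
    Joinable (a.subst σ) (a.subst τ) := by
  induction a with
  | var n => exact fun h => h n
  | app _ _ iha ihb => exact fun h => (iha h).app (ihb h)
  | lam _ ih => exact fun h => (ih (Joinable.up h)).lam
  | succ _ ih => exact fun h => (ih h).succ
  | recNat _ _ _ iha ihb ihc => exact fun h => (iha h).recNat (ihb h) (ihc h)
  | cons _ _ iha ihb => exact fun h => (iha h).cons (ihb h)
  | recVec _ _ _ iha ihb ihc => exact fun h => (iha h).recVec (ihb h) (ihc h)
  | zero | nil | join => exact fun _ => .refl _

theorem Joinable.scons {a b : Tm} {σ τ : ℕ → Tm} (hab : Joinable a b)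
    (h : ∀ n, Joinable (σ n) (τ n)) : ∀ n, Joinable (scons a σ n) (scons b τ n)
  | 0 => hab
  | n + 1 => h n

/-! ### Realizability interpretation of types -/

/-- Terms that are convertible to a numeral. -/
inductive NatSem : Tm → Prop
  | zero {c : Tm} : Joinable c .zero → NatSem c
  | succ {c d : Tm} : NatSem d → Joinable c (.succ d) → NatSem c

/-- `VecSem P l c`: up to conversion, `c` is a vector of elements satisfying `P`, and `l` is the
numeral for its length. -/
inductive VecSem (P : Tm → Prop) : Tm → Tm → Prop
  | nil {l c : Tm} : Joinable l .zero → Joinable c .nil → VecSem P l c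
  | cons {l m c a d : Tm} : P a → VecSem P m d → Joinable l (.succ m) →
      Joinable c (.cons a d) → VecSem P l c

/-- The set of realizers of a type under a valuation of its free variables. -/
def Ty.sem : Ty → (ℕ → Tm) → Tm → Prop
  | .nat, _ => NatSem
  | .vec φ l, σ => VecSem (φ.sem σ) (l.subst σ)
  | .pi φ ψ, σ => fun c => ∀ a, φ.sem σ a → ψ.sem (scons a σ) (.app c a)
  | .all φ ψ, σ => fun c => ∀ a, φ.sem σ a → ψ.sem (scons a σ) c
  | .eq a b, σ => fun _ => Joinable (a.subst σ) (b.subst σ)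

theorem NatSem.congr {c d : Tm} (h : NatSem c) (hcd : Joinable c d) : NatSem d := by
  cases h with
  | zero h => exact .zero (hcd.symm.trans h)
  | succ hd h => exact .succ hd (hcd.symm.trans h)

theorem VecSem.congr {P Q : Tm → Prop} (hPQ : ∀ a, P a → Q a) {l c : Tm} (h : VecSem P l c) :
    ∀ {l' c' : Tm}, Joinable l l' → Joinable c c' → VecSem Q l' c' := by
  induction h with
  | nil hl hc => exact fun h₁ h₂ => .nil (h₁.symm.trans hl) (h₂.symm.trans hc)
  | cons ha _ hl hc ih =>
    exact fun h₁ h₂ => .cons (hPQ _ ha) (ih (.refl _) (.refl _)) (h₁.symm.trans hl)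
      (h₂.symm.trans hc)

/-- Realizer and valuation must vary together: Π and ∀ extend the valuation, and their domains are
contravariant, so the change is reversed there by symmetry. -/
theorem Ty.sem_congr (φ : Ty) : ∀ {σ τ : ℕ → Tm} {c d : Tm}, φ.sem σ c →
    (∀ n, Joinable (σ n) (τ n)) → Joinable c d → φ.sem τ d := by
  induction φ with
  | nat => exact fun h _ hcd => NatSem.congr h hcd
  | vec φ l ih =>
    exact fun h hst hcd => VecSem.congr (fun a ha => ih ha hst (.refl a)) h
      (Joinable.subst_congr l hst) hcd
  | pi φ ψ ihφ ihψ =>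
    exact fun h hst hcd a ha => ihψ (h a (ihφ ha (fun n => (hst n).symm) (.refl a)))
      (Joinable.scons (.refl a) hst) (hcd.app (.refl a))
  | all φ ψ ihφ ihψ =>
    exact fun h hst hcd a ha => ihψ (h a (ihφ ha (fun n => (hst n).symm) (.refl a)))
      (Joinable.scons (.refl a) hst) hcd
  | eq a b =>
    exact fun h hst _ => ((Joinable.subst_congr a hst).symm.trans h).trans
      (Joinable.subst_congr b hst)

theorem Ty.sem_joinable {φ : Ty} {σ : ℕ → Tm} {c d : Tm} (h : φ.sem σ c) (hcd : Joinable c d) :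
    φ.sem σ d :=
  φ.sem_congr h (fun _ => .refl _) hcd

theorem Ty.sem_subst (φ : Ty) : ∀ τ σ : ℕ → Tm,
    (φ.subst τ).sem σ = φ.sem (fun n => (τ n).subst σ) := by
  induction φ <;> intro τ σ <;> simp_all [Ty.sem, Ty.subst, Tm.subst_subst, subst_up_scons]

theorem Ty.sem_inst (φ : Ty) (a : Tm) (σ : ℕ → Tm) :
    (φ.inst a).sem σ = φ.sem (scons (a.subst σ) σ) := by
  rw [Ty.inst, Ty.sem_subst, subst_scons]
  rfl

/-- The valuation `σ` realizes every declaration of `Γ`. -/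
def Ctx.Sem (Γ : Ctx) (σ : ℕ → Tm) : Prop :=
  ∀ (i : ℕ) (φ : Ty), Γ[i]? = some φ → φ.sem (fun n => σ (n + (i + 1))) (σ i)

theorem Ctx.Sem.cons {Γ : Ctx} {σ : ℕ → Tm} (h : Γ.Sem σ) {φ : Ty} {a : Tm} (ha : φ.sem σ a) :
    Ctx.Sem (φ :: Γ) (scons a σ)
  | 0, ψ, hψ => by
    obtain rfl : φ = ψ := by simpa using hψ
    exact ha
  | i + 1, ψ, hψ => h i ψ (by simpa using hψ)

/-- Induction on the numeral: convert the scrutinee to canonical form, fire the recursor, and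
transport back along joinability. -/
theorem Ty.sem_recNat {φ : Ty} {σ : ℕ → Tm} {a b c : Tm} (hc : NatSem c)
    (ha : φ.sem (scons .zero σ) a)
    (hb : ∀ y, NatSem y → ∀ u, φ.sem (scons y σ) u →
      φ.sem (scons (.succ y) σ) (.app (.app b y) u)) :
    φ.sem (scons c σ) (.recNat a b c) := by
  induction hc with
  | @zero c hc =>
    exact φ.sem_congr ha (Joinable.scons hc.symm fun _ => .refl _)
      (((Joinable.refl a).recNat (.refl b) hc).trans (Step.recNat_zero a b).joinable).symm
  | @succ c d hd hc ih =>
    exact φ.sem_congr (hb d hd _ ih) (Joinable.scons hc.symm fun _ => .refl _)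
      (((Joinable.refl a).recNat (.refl b) hc).trans (Step.recNat_succ a b d).joinable).symm

/-- Supplies the realizer for `∀ k : nat` in the step type of the vector recursor. -/
theorem VecSem.natSem {P : Tm → Prop} {l c : Tm} (h : VecSem P l c) : NatSem l := by
  induction h with
  | nil hl _ => exact .zero hl
  | cons _ _ hl _ ih => exact .succ ih hl

theorem Ty.sem_recVec {φ : Ty} {P : Tm → Prop} {σ : ℕ → Tm} {a b c l : Tm} (hc : VecSem P l c)
    (ha : φ.sem (scons .nil (scons .zero σ)) a)
    (hb : ∀ z, P z → ∀ k, NatSem k → ∀ v, VecSem P k v → ∀ u, φ.sem (scons v (scons k σ)) u →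
      φ.sem (scons (.cons z v) (scons (.succ k) σ)) (.app (.app (.app b z) v) u)) :
    φ.sem (scons c (scons l σ)) (.recVec a b c) := by
  induction hc with
  | nil hl hc =>
    exact φ.sem_congr ha (Joinable.scons hc.symm (Joinable.scons hl.symm fun _ => .refl _))
      (((Joinable.refl a).recVec (.refl b) hc).trans (Step.recVec_nil a b).joinable).symm
  | cons hz hv hl hc ih =>
    exact φ.sem_congr (hb _ hz _ hv.natSem _ hv _ ih)
      (Joinable.scons hc.symm (Joinable.scons hl.symm fun _ => .refl _))
      (((Joinable.refl a).recVec (.refl b) hc).trans (Step.recVec_cons a b _ _).joinable).symm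

/-- Soundness of type assignment for the realizability interpretation. -/
theorem HasType.sem {Γ : Ctx} {a : Tm} {φ : Ty} (h : HasType Γ a φ) :
    ∀ {σ : ℕ → Tm}, Γ.Sem σ → φ.sem σ (a.subst σ) := by
  induction h with
  | var hi _ =>
    intro σ hσ
    rw [Ty.sem_subst]
    exact hσ _ _ hi
  | join h _ => exact fun {σ} _ => h.subst σ
  | conv _ _ ih₁ ih₂ =>
    intro σ hσ
    have h := ih₂ hσ
    rw [Ty.sem_inst] at h ⊢
    -- A realized equation is precisely joinability of the two substituted terms.
    exact Ty.sem_congr _ h (Joinable.scons (ih₁ hσ) fun _ => .refl _) (.refl _)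
  | spec_abs _ ih =>
    intro σ hσ b hb
    have h := ih (hσ.cons hb)
    -- Shifting past the new variable discards `b`, so one term realizes every instance.
    rw [Tm.subst_subst] at h
    exact h
  | spec_app _ _ ih₁ ih₂ =>
    intro σ hσ
    rw [Ty.sem_inst]
    exact ih₁ hσ _ (ih₂ hσ)
  | abs _ ih =>
    intro σ hσ b hb
    -- The hypothesis concerns the β-contractum; closure under joinability returns to the redex.
    refine Ty.sem_joinable (ih (hσ.cons hb)) ?_
    rw [← Tm.subst_up_inst]
    exact (Step.beta _ _).joinable.symm
  | app _ _ ih₁ ih₂ =>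
    intro σ hσ
    rw [Ty.sem_inst]
    exact ih₁ hσ _ (ih₂ hσ)
  | zero _ => exact fun _ => .zero (.refl _)
  | nil _ => exact fun _ => .nil (.refl _) (.refl _)
  | succ _ ih => exact fun hσ => .succ (ih hσ) (.refl _)
  | cons _ _ ih₁ ih₂ => exact fun hσ => .cons (ih₁ hσ) (ih₂ hσ) (.refl _) (.refl _)
  | recNat _ _ _ ih₁ ih₂ ih₃ =>
    intro σ hσ
    have h₂ := ih₂ hσ
    have h₃ := ih₃ hσ
    rw [Ty.sem_inst] at h₂ ⊢
    simp only [Ty.sem, Ty.sem_subst, subst_scons] at h₃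
    exact Ty.sem_recNat (ih₁ hσ) h₂ h₃
  | recVec _ _ _ ih₁ ih₂ ih₃ =>
    intro σ hσ
    have h₂ := ih₂ hσ
    have h₃ := ih₃ hσ
    simp only [Ty.sem, Ty.sem_subst, subst_scons] at h₂ h₃ ⊢
    exact Ty.sem_recVec (ih₁ hσ) h₂ h₃

end Tvec

theorem mainTheorem5 (a b₁ b₂ : Tvec.Tm) (h : Tvec.HasType [] a (Tvec.Ty.eq b₁ b₂)) :
    Tvec.Joinable b₁ b₂ := by
  have key := h.sem (σ := .var) (fun i φ hi => by simp at hi)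
  simpa only [Tvec.Ty.sem, Tvec.Tm.subst_var] using key
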